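/- Let $n\ge 1$ and $N=\{1,\dots,n\}$, with permutations written on the right (so $\alpha\beta$ means first $\alpha$, then $\beta$). Let $S=\mathcal{FP}^+(S_n)$ be the semigroup of all nonempty subsets of the symmetric group $S_n$ with the product $A\cdot B=\{\alpha\beta:\alpha\in A,\ \beta\in B\}$, modulo the congruence $A\sim B$ if and only if $\{i\alpha:\alpha\in A\}=\{i\beta:\beta\in B\}$ for every $i\in N$. Its zero element is the class of $S_n$. A subsemigroup $T$ of $S$ is nilpotent if $T^m=\{0\}$ for some integer $m\ge 1$; a maximal nilpotent subsemigroup is one that is maximal with respect to inclusion among all nilpotent subsemigroups. Let $R(S)$ be the set of all $x\in S$ for which the two-sided ideal $S^1xS^1$ is nilpotent. For a partition $e$ of $N$, regarded as an equivalence relation, denote also by $e$ the idempotent of $S$ that is the class of $\{\alpha\in S_n: i\alpha \text{ is } e\text{-equivalent to } i \text{ for all } i\in N\}$. For $1\le k\le\lfloor n/2\rfloor$ let $\mathcal M_k$ be the set of partitions of $N$ into two blocks whose smaller block has exactly $k$ elements (for $n=2k$ both blocks have $k$ elements), and let $\mathcal M=\bigcup_k\mathcal M_k$. **Theorem.** For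 a maximal nilpotent subsemigroup $T$ of $S$ and $1\le k\le\lfloor n/2\rfloor$ let $\rho_{T,k}$ be the relation on $\mathcal M_k$ consisting of all pairs $(e,f)$ such that $exf\notin R(S)$ for some $x\in T$. Then each $\rho_{T,k}$ is a strict linear order on $\mathcal M_k$, and $T\mapsto(\rho_{T,1},\dots,\rho_{T,\lfloor n/2\rfloor})$ is a bijection between the maximal nilpotent subsemigroups of $S$ and the collections $(\rho_1,\dots,\rho_{\lfloor n/2\rfloor})$ of strict linear orders on the sets $\mathcal M_1,\dots,\mathcal M_{\lfloor n/2\rfloor}$. Its inverse sends $(\rho_1,\dots,\rho_{\lfloor n/2\rfloor})$ to $$\{x\in S:\ \text{for all } e,f\in\mathcal M,\ exf\notin R(S) \text{ implies } (e,f)\in\rho_1\cup\dots\cup\rho_{\lfloor n/2\rfloor}\}.$$ In particular, the number of maximal nilpotent subsemigroups of $\mathcal{FP}^+(S_n)$ is $$\prod_{i=1}^{k}\binom{n}{i}!\quad\text{if } n=2k+1,\qquad\text{and}\qquad \Bigl(\tfrac12\tbinom{n}{k}\Bigr)!\,\prod_{i=1}^{k-1}\binom{n}{i}!\quad\text{if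 } n=2k .$$ -/

import Mathlib

open scoped Nat

namespace NilFP

/-! ### Nilpotency in a semigroup with zero -/

/-- `setPow T k` is the set of all products of `k + 1` elements of `T`, i.e. `T ^ (k + 1)`. -/
def setPow {S : Type*} [Mul S] (T : Set S) : ℕ → Set S
  | 0 => T
  | k + 1 => Set.image2 (fun a b => a * b) (setPow T k) T

/-- A subset `T` is nilpotent if `T ^ m = {0}` for some positive integer `m`. -/
def IsNilpotentSet {S : Type*} [SemigroupWithZero S] (T : Set S) : Prop :=
  ∃ k : ℕ, setPow T k = {0}

/-- Maximal elements, with respect to inclusion, of the set of all nilpotent subsemigroups. -/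
def IsMaximalNilpotent {S : Type*} [SemigroupWithZero S] (T : Subsemigroup S) : Prop :=
  Maximal (fun U : Subsemigroup S => IsNilpotentSet (U : Set S)) T

/-- The two-sided ideal `S¹ x S¹` generated by `x`. -/
def principalIdeal {S : Type*} [Mul S] (x : S) : Set S :=
  {y | y = x ∨ (∃ a, y = a * x) ∨ (∃ b, y = x * b) ∨ ∃ a b, y = a * x * b}

/-- The radical: all `x` such that the ideal generated by `x` is a nilpotent semigroup. -/
def radical (S : Type*) [SemigroupWithZero S] : Set S :=
  {x | IsNilpotentSet (principalIdeal x)}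

/-! ### The factor power of the symmetric group -/

/-- Nonempty subsets `A` of the symmetric group on `Fin n`. -/
abbrev NonemptySubset (n : ℕ) : Type := {A : Set (Equiv.Perm (Fin n)) // A.Nonempty}

/-- `A ~ B` if `{i α : α ∈ A} = {i β : β ∈ B}` for every point `i`. -/
instance factorSetoid (n : ℕ) : Setoid (NonemptySubset n) where
  r A B := ∀ i : Fin n, (fun α : Equiv.Perm (Fin n) => α i) '' A.1 =
    (fun β : Equiv.Perm (Fin n) => β i) '' B.1
  iseqv := ⟨fun _ _ => rfl, fun h i => (h i).symm, fun h h' i => (h i).trans (h' i)⟩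

/-- The factor power `FP⁺(S_n)`: the nonempty subsets of `S_n` modulo `~`. -/
def FPplus (n : ℕ) : Type := Quotient (factorSetoid n)

/-- The elementwise product `A · B = {α β : α ∈ A, β ∈ B}`. Permutations act on the right, so that
`α β` means "first `α`, then `β`", which is `α.trans β`. -/
def mulSubset {n : ℕ} (A B : NonemptySubset n) : NonemptySubset n :=
  ⟨Set.image2 (fun α β => α.trans β) A.1 B.1, A.2.image2 B.2⟩

theorem mem_mulSubset_image {n : ℕ} (A B : NonemptySubset n) (i j : Fin n) :
    j ∈ (fun γ : Equiv.Perm (Fin n) => γ i) '' (mulSubset A B).1 ↔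
      ∃ m ∈ (fun α : Equiv.Perm (Fin n) => α i) '' A.1,
        j ∈ (fun β : Equiv.Perm (Fin n) => β m) '' B.1 := by
  constructor
  · rintro ⟨γ, ⟨α, hα, β, hβ, rfl⟩, rfl⟩
    exact ⟨α i, ⟨α, hα, rfl⟩, β, hβ, rfl⟩
  · rintro ⟨m, ⟨α, hα, rfl⟩, β, hβ, rfl⟩
    exact ⟨α.trans β, ⟨α, hα, β, hβ, rfl⟩, rfl⟩

/-- The multiplication of `FP⁺(S_n)` is induced by the elementwise product of subsets, and its
zero is the class of the whole group `S_n`. -/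
instance (n : ℕ) : SemigroupWithZero (FPplus n) where
  mul := Quotient.map₂ mulSubset (by
    intro A A' hA B B' hB i
    ext j
    rw [mem_mulSubset_image, mem_mulSubset_image, hA i]
    simp only [hB _])
  mul_assoc := by
    rintro ⟨A⟩ ⟨B⟩ ⟨C⟩
    refine Quotient.sound fun i => ?_
    ext j
    simp only [mem_mulSubset_image]
    constructor
    · rintro ⟨m, ⟨l, hl, hm⟩, hj⟩
      exact ⟨l, hl, m, hm, hj⟩
    · rintro ⟨l, hl, m, hm, hj⟩
      exact ⟨m, ⟨l, hl, hm⟩, hj⟩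
  zero := Quotient.mk _ ⟨Set.univ, Set.univ_nonempty⟩
  zero_mul := by
    rintro ⟨A⟩
    refine Quotient.sound fun i => ?_
    congr 1
    refine Set.eq_univ_of_forall fun γ => ?_
    obtain ⟨α, hα⟩ := A.2
    refine ⟨γ.trans α.symm, Set.mem_univ _, α, hα, ?_⟩
    ext x
    simp
  mul_zero := by
    rintro ⟨A⟩
    refine Quotient.sound fun i => ?_
    congr 1
    refine Set.eq_univ_of_forall fun γ => ?_
    obtain ⟨α, hα⟩ := A.2
    refine ⟨α, hα, α.symm.trans γ, Set.mem_univ _, ?_⟩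
    ext x
    simp

/-- The binary relation `{(i, i α) : α ∈ A}` on `Fin n` associated with the class of `A`. -/
def FPplus.rel {n : ℕ} (a : FPplus n) (i j : Fin n) : Prop :=
  Quotient.liftOn a (fun A => j ∈ (fun α : Equiv.Perm (Fin n) => α i) '' A.1)
    (fun _ _ h => by simp only [h i])

/-- The idempotent of `FP⁺(S_n)` given by an equivalence relation `r` on `Fin n` (equivalently, by
the partition into the classes of `r`): the class of the set of all permutations which map every
point to an `r`-equivalent one. Its binary relation is `r`, see `rel_idem`. -/
def idem {n : ℕ} (r : Setoid (Fin n)) : FPplus n :=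
  Quotient.mk _ ⟨{α | ∀ i, r i (α i)}, ⟨1, fun i => r.refl i⟩⟩

theorem rel_idem {n : ℕ} (r : Setoid (Fin n)) (i j : Fin n) : (idem r).rel i j ↔ r i j := by
  constructor
  · rintro ⟨α, hα, rfl⟩
    exact hα i
  · intro h
    refine ⟨Equiv.swap i j, fun x => ?_, Equiv.swap_apply_left i j⟩
    rcases eq_or_ne x i with rfl | hi
    · simpa using h
    · rcases eq_or_ne x j with rfl | hj
      · simpa using r.symm h
      · simpa [Equiv.swap_apply_of_ne_of_ne hi hj] using r.refl x

theorem idem_mul_self {n : ℕ} (r : Setoid (Fin n)) : idem r * idem r = idem r := by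
  refine Quotient.sound fun i => ?_
  congr 1
  ext γ
  constructor
  · rintro ⟨α, hα, β, hβ, rfl⟩ i
    exact r.trans (hα i) (hβ (α i))
  · intro h
    exact ⟨1, fun i => r.refl i, γ, h, by ext x; rfl⟩

/-- `M n k` is the set of partitions of `Fin n` (given as equivalence relations) into two blocks
such that the smaller block has `k` elements. -/
def M (n k : ℕ) : Set (Setoid (Fin n)) :=
  {r | r.classes.ncard = 2 ∧
    (∃ c ∈ r.classes, c.ncard = k) ∧ ∀ c ∈ r.classes, k ≤ c.ncard}

/-! ### Linear orders and the two maps -/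

/-- Collections of (strict) linear orders on `M n 1, …, M n ⌊n/2⌋`. -/
abbrev LinearOrders (n : ℕ) : Type :=
  (k : Set.Icc 1 (n / 2)) → {ρ : M n k → M n k → Prop // IsStrictTotalOrder (M n k) ρ}

/-- The maximal nilpotent subsemigroups of `FP⁺(S_n)`. -/
abbrev MaxNil (n : ℕ) : Type := {T : Subsemigroup (FPplus n) // IsMaximalNilpotent T}

/-- The relation induced by a subset `T` of `FP⁺(S_n)` on partitions: `e x f` is nonzero modulo
the radical for some `x ∈ T`. -/
def inducedRel {n : ℕ} (T : Set (FPplus n)) (e f : Setoid (Fin n)) : Prop :=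
  ∃ x ∈ T, idem e * x * idem f ∉ radical (FPplus n)

/-- The union of a collection of orders on the sets `M n k`. -/
def unionRel {n : ℕ} (ρ : LinearOrders n) (e f : Setoid (Fin n)) : Prop :=
  ∃ (k : Set.Icc 1 (n / 2)) (he : e ∈ M n k) (hf : f ∈ M n k), (ρ k).1 ⟨e, he⟩ ⟨f, hf⟩

/-- All `x` such that, for all two-block partitions `e`, `f`, if `e x f` is nonzero modulo the
radical, then `e` precedes `f`. -/
def Mon {n : ℕ} (ρ : LinearOrders n) : Set (FPplus n) :=
  {x | ∀ e f : Setoid (Fin n), e.classes.ncard = 2 → f.classes.ncard = 2 →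
    idem e * x * idem f ∉ radical (FPplus n) → unionRel ρ e f}

end NilFP

/-!
Through the relation `{(i, i α) : α ∈ A}` the elements of `FP⁺(S_n)` become exactly the binary
relations which are unions of permutations, multiplied by composition. Such a relation `x` never
shrinks a set of points, and if the image `A x` is as small as `A`, then every permutation inside
`x` maps `A` onto `A x`, so `x` splits into a part from `A` to `A x` and a part between the
complements (`img_compl`). Hence `x` acts as a partial injective map on the partitions into two
blocks, `Carries x e f`, and a product acts by the composite of the partial maps
(`carries_mul_iff`).

The radical consists of the `x` which carry nothing, that is, which strictly enlarge every nonempty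
proper subset (`mem_radical_iff`, `notMem_radical_iff_exists_carries`): products of such elements
reach the full relation within `n` steps, whereas otherwise some multiple of `x` fixes a nonempty
proper subset. The only partition carried by the idempotent of a two-block partition is this
partition itself, so `e x f ∉ R(S)` just says that `x` carries `e` to `f`
(`idem_mul_mul_idem_notMem_radical_iff`).

The relation on partitions induced by a subsemigroup `U` is therefore transitive, and `U` is
nilpotent exactly when this relation is a strict order
(`isNilpotentSet_subsemigroup_iff`): in a finite strict order chains are short, so long
products in `U` carry nothing, and long products of such elements vanish. Extending the order
linearly on each `M n k` shows that `U` lies in some `Mon ρ` (`exists_le_Mon`). Conversely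
`e σ f`, for a permutation `σ` mapping `e` to `f`, carries only `e` and only to `f`
(`exists_carries_iff`), so `Mon ρ` induces exactly `ρ`; as `ρ` is linear, `Mon ρ` is maximal
(`isMaximalNilpotent_Mon`). The numbers follow by counting the sets `M n k` and the linear orders
on a finite set.
-/

namespace NilFP

variable {n : ℕ}

/-! ### Elements of the factor power as binary relations -/

theorem rel_mul (a b : FPplus n) (i j : Fin n) :
    (a * b).rel i j ↔ ∃ m, a.rel i m ∧ b.rel m j := by
  induction a using Quotient.inductionOn
  induction b using Quotient.inductionOn
  exact mem_mulSubset_image _ _ i j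

theorem rel_zero (i j : Fin n) : (0 : FPplus n).rel i j :=
  ⟨Equiv.swap i j, Set.mem_univ _, Equiv.swap_apply_left i j⟩

theorem FPplus.ext {a b : FPplus n} (h : ∀ i j, a.rel i j ↔ b.rel i j) : a = b := by
  induction a using Quotient.inductionOn
  induction b using Quotient.inductionOn
  exact Quotient.sound fun i => Set.ext fun j => h i j

/-- Every element is a union of permutations: each of its pairs lies on a permutation contained
in it. -/
theorem exists_perm_of_rel {a : FPplus n} {i j : Fin n} (h : a.rel i j) :
    ∃ σ : Equiv.Perm (Fin n), σ i = j ∧ ∀ l, a.rel l (σ l) := by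
  induction a using Quotient.inductionOn
  obtain ⟨σ, hσ, rfl⟩ := h
  exact ⟨σ, rfl, fun l => ⟨σ, hσ, rfl⟩⟩

theorem exists_perm (a : FPplus n) : ∃ σ : Equiv.Perm (Fin n), ∀ l, a.rel l (σ l) := by
  induction a using Quotient.inductionOn with
  | _ A =>
    obtain ⟨σ, hσ⟩ := A.2
    exact ⟨σ, fun l => ⟨σ, hσ, rfl⟩⟩

/-- The class of the singleton `{σ}`. -/
def ofPerm (σ : Equiv.Perm (Fin n)) : FPplus n :=
  Quotient.mk _ ⟨{σ}, Set.singleton_nonempty σ⟩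

theorem rel_ofPerm (σ : Equiv.Perm (Fin n)) (i j : Fin n) : (ofPerm σ).rel i j ↔ σ i = j := by
  constructor
  · rintro ⟨_, rfl, rfl⟩
    rfl
  · rintro rfl
    exact ⟨σ, rfl, rfl⟩

/-- The image of a set of points under (the binary relation of) an element of the factor power. -/
def img (a : FPplus n) (A : Set (Fin n)) : Set (Fin n) := {j | ∃ i ∈ A, a.rel i j}

theorem img_mul (a b : FPplus n) (A : Set (Fin n)) : img (a * b) A = img b (img a A) := by
  ext j
  simp only [img, Set.mem_ofPred_eq, rel_mul]
  constructor
  · rintro ⟨i, hi, m, h, h'⟩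
    exact ⟨m, ⟨i, hi, h⟩, h'⟩
  · rintro ⟨m, ⟨i, hi, h⟩, h'⟩
    exact ⟨i, hi, m, h, h'⟩

theorem img_ofPerm (σ : Equiv.Perm (Fin n)) (A : Set (Fin n)) : img (ofPerm σ) A = σ '' A := by
  ext j
  simp only [img, Set.mem_ofPred_eq, rel_ofPerm, Set.mem_image]

theorem img_zero {A : Set (Fin n)} (hA : A.Nonempty) : img 0 A = Set.univ :=
  Set.eq_univ_of_forall fun j => ⟨_, hA.some_mem, rel_zero _ j⟩

theorem subset_img_idem (r : Setoid (Fin n)) (A : Set (Fin n)) : A ⊆ img (idem r) A :=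
  fun i hi => ⟨i, hi, (rel_idem r i i).2 (r.refl i)⟩

theorem image_perm_subset_img {a : FPplus n} {σ : Equiv.Perm (Fin n)} (h : ∀ l, a.rel l (σ l))
    (A : Set (Fin n)) : σ '' A ⊆ img a A := by
  rintro _ ⟨i, hi, rfl⟩
  exact ⟨i, hi, h i⟩

theorem ncard_le_ncard_img (a : FPplus n) (A : Set (Fin n)) : A.ncard ≤ (img a A).ncard := by
  obtain ⟨σ, hσ⟩ := exists_perm a
  rw [← Set.ncard_image_of_injective A σ.injective]
  exact Set.ncard_le_ncard (image_perm_subset_img hσ A)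

/-- If the image of `A` is no larger than `A`, then every permutation contained in `a` maps `A`
onto this image, so `a` also maps the complement to the complement. -/
theorem img_compl {a : FPplus n} {A : Set (Fin n)} (h : (img a A).ncard = A.ncard) :
    img a Aᶜ = (img a A)ᶜ := by
  have hsub : img a Aᶜ ⊆ (img a A)ᶜ := by
    rintro j ⟨i, hi, hij⟩ hj
    obtain ⟨σ, rfl, hσ⟩ := exists_perm_of_rel hij
    have himage : σ '' A = img a A :=
      Set.eq_of_subset_of_ncard_le (image_perm_subset_img hσ A)
        (by rw [h, Set.ncard_image_of_injective A σ.injective])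
    rw [← himage, σ.injective.mem_set_image] at hj
    exact hi hj
  refine Set.eq_of_subset_of_ncard_le hsub ?_
  have h1 := ncard_le_ncard_img a Aᶜ
  rw [Set.ncard_compl] at h1 ⊢
  omega

theorem ncard_img_compl {a : FPplus n} {A : Set (Fin n)} (h : (img a A).ncard = A.ncard) :
    (img a Aᶜ).ncard = Aᶜ.ncard := by
  rw [img_compl h, Set.ncard_compl, Set.ncard_compl, h]

/-- In a product that preserves the size of `A`, each factor preserves the size. -/
theorem ncard_img_mul_iff {a b : FPplus n} {A : Set (Fin n)} :
    (img (a * b) A).ncard = A.ncard ↔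
      (img a A).ncard = A.ncard ∧ (img b (img a A)).ncard = (img a A).ncard := by
  rw [img_mul]
  have h1 := ncard_le_ncard_img a A
  have h2 := ncard_le_ncard_img b (img a A)
  omega

/-- `A` is neither empty nor the whole set of points. -/
def Proper (A : Set (Fin n)) : Prop := A.Nonempty ∧ A ≠ Set.univ

theorem proper_iff_ncard {A : Set (Fin n)} : Proper A ↔ 0 < A.ncard ∧ A.ncard < n := by
  have hle : A.ncard ≤ n := by simpa using Set.ncard_le_card A
  have huniv : A.ncard = n ↔ A = Set.univ := by
    constructor
    · intro h
      exact Set.eq_of_subset_of_ncard_le (Set.subset_univ _) (by simp [h])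
    · rintro rfl
      simp
  rw [Proper, ← Set.ncard_pos, Ne, ← huniv]
  omega

theorem Proper.compl {A : Set (Fin n)} (h : Proper A) : Proper Aᶜ := by
  rw [proper_iff_ncard] at *
  rw [Set.ncard_compl, Nat.card_eq_fintype_card, Fintype.card_fin]
  omega

theorem Proper.of_ncard_eq {A B : Set (Fin n)} (h : Proper A) (hB : B.ncard = A.ncard) :
    Proper B := by
  rw [proper_iff_ncard] at *
  omega

theorem exists_perm_image_eq {A B : Set (Fin n)} (h : A.ncard = B.ncard) :
    ∃ σ : Equiv.Perm (Fin n), σ '' A = B := by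
  classical
  have e : A ≃ B := (Finite.card_eq.1 h).some
  refine ⟨e.extendSubtype, Set.eq_of_subset_of_ncard_le ?_ ?_⟩
  · rintro _ ⟨i, hi, rfl⟩
    exact e.extendSubtype_mem i hi
  · rw [Set.ncard_image_of_injective A (Equiv.injective _), h]

/-! ### The radical -/

/-- Products of `k + 1` elements that strictly enlarge all proper subsets enlarge any proper
subset by at least `k + 1` points, as long as there is room. -/
theorem min_le_ncard_img {P : Set (FPplus n)}
    (hP : ∀ x ∈ P, ∀ A, Proper A → A.ncard < (img x A).ncard) (k : ℕ) :
    ∀ x ∈ setPow P k, ∀ A : Set (Fin n), A.Nonempty →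
      min n (A.ncard + k + 1) ≤ (img x A).ncard := by
  have key : ∀ x ∈ P, ∀ A : Set (Fin n), A.Nonempty → min n (A.ncard + 1) ≤ (img x A).ncard := by
    intro x hx A hA
    by_cases hA' : Proper A
    · exact (min_le_right _ _).trans (hP x hx A hA')
    · rw [proper_iff_ncard] at hA'
      have h1 := hA.ncard_pos
      have h2 := ncard_le_ncard_img x A
      omega
  induction k with
  | zero => exact key
  | succ k ih =>
    rintro _ ⟨x, hx, y, hy, rfl⟩ A hA
    have h1 := ih x hx A hA
    have h2 := ncard_le_ncard_img x A
    have hpos := hA.ncard_pos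
    have h3 := key y hy (img x A) (Set.nonempty_of_ncard_ne_zero (by omega))
    simp only [img_mul]
    omega

theorem setPow_subset_zero {P : Set (FPplus n)}
    (hP : ∀ x ∈ P, ∀ A, Proper A → A.ncard < (img x A).ncard) : setPow P n ⊆ {0} := by
  intro x hx
  refine FPplus.ext fun i j => iff_of_true ?_ (rel_zero i j)
  have h := min_le_ncard_img hP n x hx {i} (Set.singleton_nonempty i)
  have huniv : img x {i} = Set.univ := by
    refine Set.eq_of_subset_of_ncard_le (Set.subset_univ _) ?_
    rw [Set.ncard_univ, Nat.card_eq_fintype_card, Fintype.card_fin]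
    omega
  obtain ⟨i', rfl, hij⟩ : j ∈ img x {i} := huniv ▸ Set.mem_univ j
  exact hij

theorem setPow_nonempty {S : Type*} [Mul S] {T : Set S} (hT : T.Nonempty) (k : ℕ) :
    (setPow T k).Nonempty := by
  induction k with
  | zero => exact hT
  | succ k ih => exact ih.image2 hT

theorem isNilpotentSet_iff {S : Type*} [SemigroupWithZero S] {T : Set S} :
    IsNilpotentSet T ↔ T.Nonempty ∧ ∃ k, setPow T k ⊆ {0} := by
  constructor
  · rintro ⟨k, hk⟩
    refine ⟨?_, k, hk.le⟩
    have h : (setPow T k).Nonempty := hk ▸ Set.singleton_nonempty 0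
    cases k with
    | zero => exact h
    | succ k => exact (Set.image2_nonempty_iff.1 h).2
  · rintro ⟨hT, k, hk⟩
    exact ⟨k, (Set.subset_singleton_iff_eq.1 hk).resolve_left (setPow_nonempty hT k).ne_empty⟩

theorem exists_mem_setPow_img_eq {T : Set (FPplus n)} {x : FPplus n} (hx : x ∈ T)
    {A : Set (Fin n)} (h : img x A = A) (k : ℕ) : ∃ y ∈ setPow T k, img y A = A := by
  induction k with
  | zero => exact ⟨x, hx, h⟩
  | succ k ih =>
    obtain ⟨y, hy, hyA⟩ := ih
    exact ⟨y * x, ⟨y, hy, x, hx, rfl⟩, by rw [img_mul, hyA, h]⟩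

/-- The radical consists of the elements that strictly enlarge every proper subset. -/
theorem mem_radical_iff {x : FPplus n} :
    x ∈ radical (FPplus n) ↔ ∀ A, Proper A → A.ncard < (img x A).ncard := by
  constructor
  · rintro ⟨k, hk⟩ A hA
    by_contra! hle
    -- A permutation moves the image back to `A`, which yields an element of the ideal fixing `A`.
    obtain ⟨σ, hσ⟩ := exists_perm_image_eq (hle.antisymm (ncard_le_ncard_img x A))
    obtain ⟨y, hy, hyA⟩ := exists_mem_setPow_img_eq
      (T := principalIdeal x) (x := x * ofPerm σ) (Or.inr (Or.inr (Or.inl ⟨_, rfl⟩)))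
      (A := A) (by rw [img_mul, img_ofPerm, hσ]) k
    rw [hk, Set.mem_singleton_iff] at hy
    rw [hy, img_zero hA.1] at hyA
    exact hA.2 hyA.symm
  · intro h
    refine isNilpotentSet_iff.2 ⟨⟨x, Or.inl rfl⟩, n, setPow_subset_zero ?_⟩
    have hr : ∀ y b : FPplus n, (∀ A, Proper A → A.ncard < (img y A).ncard) →
        ∀ A, Proper A → A.ncard < (img (y * b) A).ncard := fun y b hy A hA => by
      rw [img_mul]
      exact (hy A hA).trans_le (ncard_le_ncard_img b _)
    have hl : ∀ a : FPplus n, ∀ A, Proper A → A.ncard < (img (a * x) A).ncard := by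
      intro a A hA
      refine lt_of_le_of_ne (ncard_le_ncard_img _ A) fun heq => ?_
      obtain ⟨h1, h2⟩ := ncard_img_mul_iff.1 heq.symm
      exact (h _ (hA.of_ncard_eq h1)).ne h2.symm
    rintro y (rfl | ⟨a, rfl⟩ | ⟨b, rfl⟩ | ⟨a, b, rfl⟩)
    exacts [h, hl a, hr x b h, hr _ b (hl a)]

theorem notMem_radical_iff {x : FPplus n} :
    x ∉ radical (FPplus n) ↔ ∃ A, Proper A ∧ (img x A).ncard = A.ncard := by
  simp only [mem_radical_iff, not_forall, not_lt, exists_prop]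
  refine exists_congr fun A => and_congr_right fun _ => ?_
  exact ⟨fun h => h.antisymm (ncard_le_ncard_img x A), fun h => h.le⟩

/-! ### Partitions into two blocks -/

/-- The partition into `A` and its complement, as an equivalence relation. It has two blocks only
if `A` is nonempty and proper. -/
def twoBlock (A : Set (Fin n)) : Setoid (Fin n) := Setoid.ker (· ∈ A)

theorem twoBlock_rel {A : Set (Fin n)} {i j : Fin n} : twoBlock A i j ↔ (i ∈ A ↔ j ∈ A) := by
  change (i ∈ A) = (j ∈ A) ↔ _
  exact eq_iff_iff

theorem twoBlock_compl (A : Set (Fin n)) : twoBlock Aᶜ = twoBlock A := by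
  ext i j
  simp only [twoBlock_rel, Set.mem_compl_iff]
  tauto

theorem twoBlock_inj {A B : Set (Fin n)} (h : twoBlock A = twoBlock B) : A = B ∨ A = Bᶜ := by
  have h' : ∀ i j, (i ∈ A ↔ j ∈ A) ↔ (i ∈ B ↔ j ∈ B) := fun i j => by
    rw [← twoBlock_rel, ← twoBlock_rel, h]
  by_cases hAB : ∃ i, ¬(i ∈ A ↔ i ∈ B)
  · obtain ⟨i, hi⟩ := hAB
    right
    ext j
    have := h' i j
    rw [Set.mem_compl_iff]
    tauto
  · left
    ext j
    push Not at hAB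
    exact hAB j

theorem classes_twoBlock {A : Set (Fin n)} (hA : Proper A) : (twoBlock A).classes = {A, Aᶜ} := by
  have hmem : ∀ j ∈ A, {i | twoBlock A i j} = A := fun j hj => by
    ext i
    simp [twoBlock_rel, hj]
  have hnot : ∀ j ∉ A, {i | twoBlock A i j} = Aᶜ := fun j hj => by
    ext i
    simp [twoBlock_rel, hj]
  ext c
  constructor
  · rintro ⟨j, rfl⟩
    by_cases hj : j ∈ A
    exacts [Or.inl (hmem j hj), Or.inr (hnot j hj)]
  · rintro (rfl | rfl)
    · obtain ⟨j, hj⟩ := hA.1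
      exact ⟨j, (hmem j hj).symm⟩
    · obtain ⟨j, hj⟩ := (Set.ne_univ_iff_exists_notMem _).1 hA.2
      exact ⟨j, (hnot j hj).symm⟩

theorem ncard_classes_twoBlock {A : Set (Fin n)} (hA : Proper A) :
    (twoBlock A).classes.ncard = 2 := by
  rw [classes_twoBlock hA]
  refine Set.ncard_pair fun h => ?_
  obtain ⟨i, hi⟩ := hA.1
  exact (h ▸ hi : i ∈ Aᶜ) hi

theorem exists_eq_twoBlock {r : Setoid (Fin n)} (h : r.classes.ncard = 2) :
    ∃ A, Proper A ∧ r = twoBlock A := by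
  obtain ⟨A, B, hAB, hr⟩ := Set.ncard_eq_two.1 h
  have hA : A ∈ r.classes := hr ▸ Set.mem_insert _ _
  have hB : B ∈ r.classes := hr ▸ Set.mem_insert_of_mem _ rfl
  have hpart := Setoid.isPartition_classes r
  have hBne := Setoid.nonempty_of_mem_partition hpart hB
  have hdisj : Disjoint A B := hpart.pairwiseDisjoint hA hB hAB
  have hunion : A ∪ B = Set.univ := by
    rw [← hpart.sUnion_eq_univ, hr, Set.sUnion_pair]
  have hcompl : B = Aᶜ :=
    (IsCompl.of_eq hdisj.inter_eq hunion).compl_eq.symm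
  have hproper : Proper A := by
    refine ⟨Setoid.nonempty_of_mem_partition hpart hA, ?_⟩
    rintro rfl
    rw [hcompl, Set.compl_univ] at hBne
    exact Set.not_nonempty_empty hBne
  exact ⟨A, hproper, Setoid.classes_inj.2 (by rw [hr, classes_twoBlock hproper, hcompl])⟩

theorem twoBlock_mem_M_iff {A : Set (Fin n)} (hA : Proper A) {k : ℕ} :
    twoBlock A ∈ M n k ↔ k = min A.ncard (n - A.ncard) := by
  have hc : Aᶜ.ncard = n - A.ncard := by
    rw [Set.ncard_compl, Nat.card_eq_fintype_card, Fintype.card_fin]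
  have h2 := ncard_classes_twoBlock hA
  rw [classes_twoBlock hA] at h2
  simp only [M, Set.mem_ofPred_eq, classes_twoBlock hA, h2,
    Set.mem_insert_iff, Set.mem_singleton_iff, exists_eq_or_imp, exists_eq_left,
    forall_eq_or_imp, forall_eq, hc, true_and]
  omega

theorem mem_M_iff {r : Setoid (Fin n)} {k : ℕ} (hk : 1 ≤ k) :
    r ∈ M n k ↔ ∃ A : Set (Fin n), A.ncard = k ∧ 2 * k ≤ n ∧ r = twoBlock A := by
  constructor
  · intro h
    obtain ⟨A, hA, rfl⟩ := exists_eq_twoBlock h.1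
    rw [twoBlock_mem_M_iff hA] at h
    have hA' := proper_iff_ncard.1 hA
    rcases le_total A.ncard (n - A.ncard) with hle | hle
    · exact ⟨A, by omega, by omega, rfl⟩
    · refine ⟨Aᶜ, ?_, by omega, (twoBlock_compl A).symm⟩
      rw [Set.ncard_compl, Nat.card_eq_fintype_card, Fintype.card_fin]
      omega
  · rintro ⟨A, hA, hkn, rfl⟩
    rw [twoBlock_mem_M_iff (proper_iff_ncard.2 (by omega))]
    omega

theorem M_unique {r : Setoid (Fin n)} {k l : ℕ} (hk : r ∈ M n k) (hl : r ∈ M n l) : k = l := by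
  obtain ⟨A, hA, rfl⟩ := exists_eq_twoBlock hk.1
  rw [(twoBlock_mem_M_iff hA).1 hk, (twoBlock_mem_M_iff hA).1 hl]

theorem exists_mem_M {r : Setoid (Fin n)} (h : r.classes.ncard = 2) :
    ∃ k : Set.Icc 1 (n / 2), r ∈ M n k := by
  obtain ⟨A, hA, rfl⟩ := exists_eq_twoBlock h
  have hA' := proper_iff_ncard.1 hA
  exact ⟨⟨min A.ncard (n - A.ncard), by rw [Set.mem_Icc]; omega⟩, (twoBlock_mem_M_iff hA).2 rfl⟩

instance : Finite (Setoid (Fin n)) :=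
  Finite.of_injective Setoid.classes fun _ _ h => Setoid.classes_inj.2 h

/-! ### The partial action on two-block partitions -/

/-- `Carries x e f` says that `x` carries the two-block partition `e` to the partition `f`: it
relates the points of each block of `e` only to points of one block of `f` of the same size. It
suffices to ask this of one block. This is a partial injective map on two-block partitions. -/
def Carries (x : FPplus n) (e f : Setoid (Fin n)) : Prop :=
  ∃ A, Proper A ∧ (img x A).ncard = A.ncard ∧ e = twoBlock A ∧ f = twoBlock (img x A)

theorem carries_twoBlock_iff {x : FPplus n} {A : Set (Fin n)} {f : Setoid (Fin n)} :
    Carries x (twoBlock A) f ↔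
      Proper A ∧ (img x A).ncard = A.ncard ∧ f = twoBlock (img x A) := by
  constructor
  · rintro ⟨B, hB, hx, hAB, rfl⟩
    rcases twoBlock_inj hAB with rfl | rfl
    · exact ⟨hB, hx, rfl⟩
    · exact ⟨hB.compl, ncard_img_compl hx, by rw [img_compl hx, twoBlock_compl]⟩
  · rintro ⟨hA, hx, hf⟩
    exact ⟨A, hA, hx, rfl, hf⟩

theorem Carries.ncard_left {x : FPplus n} {e f : Setoid (Fin n)} (h : Carries x e f) :
    e.classes.ncard = 2 := by
  obtain ⟨A, hA, -, rfl, -⟩ := h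
  exact ncard_classes_twoBlock hA

theorem Carries.ncard_right {x : FPplus n} {e f : Setoid (Fin n)} (h : Carries x e f) :
    f.classes.ncard = 2 := by
  obtain ⟨A, hA, hx, -, rfl⟩ := h
  exact ncard_classes_twoBlock (hA.of_ncard_eq hx)

theorem Carries.mem_M {x : FPplus n} {e f : Setoid (Fin n)} (h : Carries x e f) {k : ℕ}
    (he : e ∈ M n k) : f ∈ M n k := by
  obtain ⟨A, hA, hx, rfl, rfl⟩ := h
  rw [twoBlock_mem_M_iff hA] at he
  rw [twoBlock_mem_M_iff (hA.of_ncard_eq hx), hx, he]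

theorem carries_mul_iff {x y : FPplus n} {e g : Setoid (Fin n)} :
    Carries (x * y) e g ↔ ∃ f, Carries x e f ∧ Carries y f g := by
  constructor
  · rintro ⟨A, hA, hxy, rfl, rfl⟩
    obtain ⟨hx, hy⟩ := ncard_img_mul_iff.1 hxy
    exact ⟨_, ⟨A, hA, hx, rfl, rfl⟩, img x A, hA.of_ncard_eq hx, hy, rfl, by rw [img_mul]⟩
  · rintro ⟨_, ⟨A, hA, hx, rfl, rfl⟩, hf⟩
    obtain ⟨-, hy, rfl⟩ := carries_twoBlock_iff.1 hf
    exact ⟨A, hA, ncard_img_mul_iff.2 ⟨hx, hy⟩, rfl, by rw [img_mul]⟩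

theorem notMem_radical_iff_exists_carries {x : FPplus n} :
    x ∉ radical (FPplus n) ↔ ∃ e f, Carries x e f := by
  rw [notMem_radical_iff]
  constructor
  · rintro ⟨A, hA, hx⟩
    exact ⟨_, _, A, hA, hx, rfl, rfl⟩
  · rintro ⟨_, _, A, hA, hx, -, -⟩
    exact ⟨A, hA, hx⟩

theorem not_carries_zero (e f : Setoid (Fin n)) : ¬Carries 0 e f := by
  rintro ⟨A, hA, h, -, -⟩
  rw [img_zero hA.1] at h
  exact hA.2 (Set.eq_of_subset_of_ncard_le (Set.subset_univ _) h.le)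

theorem img_idem_twoBlock (A : Set (Fin n)) : img (idem (twoBlock A)) A = A := by
  refine Set.Subset.antisymm ?_ (subset_img_idem _ _)
  rintro j ⟨i, hi, hij⟩
  rw [rel_idem, twoBlock_rel] at hij
  exact hij.1 hi

theorem carries_idem_iff {r e f : Setoid (Fin n)} (hr : r.classes.ncard = 2) :
    Carries (idem r) e f ↔ e = r ∧ f = r := by
  obtain ⟨A, hA, rfl⟩ := exists_eq_twoBlock hr
  constructor
  · rintro ⟨B, hB, h, rfl, rfl⟩
    have hBimg : img (idem (twoBlock A)) B = B :=
      (Set.eq_of_subset_of_ncard_le (subset_img_idem _ B) h.le).symm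
    rw [hBimg, and_self]
    -- `B` is a nonempty proper union of classes of `twoBlock A`.
    have hsat : ∀ i j, (i ∈ A ↔ j ∈ A) → i ∈ B → j ∈ B := fun i j hij hi => by
      rw [← hBimg]
      exact ⟨i, hi, (rel_idem _ i j).2 (twoBlock_rel.2 hij)⟩
    obtain ⟨b, hb⟩ := hB.1
    obtain ⟨c, hc⟩ := (Set.ne_univ_iff_exists_notMem _).1 hB.2
    have hbc : ¬(b ∈ A ↔ c ∈ A) := fun h => hc (hsat b c h hb)
    have hmem : ∀ i, i ∈ B ↔ (b ∈ A ↔ i ∈ A) := by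
      refine fun i => ⟨fun hi => ?_, fun hi => hsat b i hi hb⟩
      by_contra hbi
      exact hc (hsat i c (by tauto) hi)
    ext i j
    rw [twoBlock_rel, twoBlock_rel, hmem i, hmem j]
    tauto
  · rintro ⟨rfl, rfl⟩
    exact ⟨A, hA, by rw [img_idem_twoBlock], rfl, by rw [img_idem_twoBlock]⟩

/-- The condition `e x f ∉ R(S)` in terms of the partial action. -/
theorem idem_mul_mul_idem_notMem_radical_iff {x : FPplus n} {e f : Setoid (Fin n)}
    (he : e.classes.ncard = 2) (hf : f.classes.ncard = 2) :
    idem e * x * idem f ∉ radical (FPplus n) ↔ Carries x e f := by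
  simp only [notMem_radical_iff_exists_carries, carries_mul_iff, carries_idem_iff he,
    carries_idem_iff hf]
  constructor
  · rintro ⟨_, _, _, ⟨_, ⟨rfl, rfl⟩, h⟩, rfl, rfl⟩
    exact h
  · intro h
    exact ⟨e, f, f, ⟨e, ⟨rfl, rfl⟩, h⟩, rfl, rfl⟩

/-- Any single pair of partitions of the same type is the whole partial map of some element. -/
theorem exists_carries_iff {k : ℕ} {e f : Setoid (Fin n)} (hk : 1 ≤ k) (he : e ∈ M n k)
    (hf : f ∈ M n k) : ∃ x : FPplus n, ∀ e' f', Carries x e' f' ↔ e' = e ∧ f' = f := by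
  obtain ⟨A, hA, hkn, rfl⟩ := (mem_M_iff hk).1 he
  obtain ⟨B, hB, -, rfl⟩ := (mem_M_iff hk).1 hf
  obtain ⟨σ, hσ⟩ := exists_perm_image_eq (hA.trans hB.symm)
  have hσc : Carries (ofPerm σ) (twoBlock A) (twoBlock B) :=
    ⟨A, proper_iff_ncard.2 (by omega), by rw [img_ofPerm, hσ, hA, hB], rfl, by
      rw [img_ofPerm, hσ]⟩
  refine ⟨idem (twoBlock A) * ofPerm σ * idem (twoBlock B), fun e' f' => ?_⟩
  simp only [carries_mul_iff, carries_idem_iff he.1, carries_idem_iff hf.1]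
  constructor
  · rintro ⟨_, ⟨_, ⟨rfl, rfl⟩, -⟩, rfl, rfl⟩
    exact ⟨rfl, rfl⟩
  · rintro ⟨rfl, rfl⟩
    exact ⟨_, ⟨_, ⟨rfl, rfl⟩, hσc⟩, rfl, rfl⟩

/-! ### Nilpotent subsemigroups -/

/-- The relation which a set of elements induces on partitions through the partial action. -/
def CarriedBy (U : Set (FPplus n)) (e f : Setoid (Fin n)) : Prop := ∃ x ∈ U, Carries x e f

theorem inducedRel_iff_carriedBy {U : Set (FPplus n)} {e f : Setoid (Fin n)}
    (he : e.classes.ncard = 2) (hf : f.classes.ncard = 2) :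
    inducedRel U e f ↔ CarriedBy U e f := by
  simp only [inducedRel, CarriedBy, idem_mul_mul_idem_notMem_radical_iff he hf]

theorem CarriedBy.trans {U : Subsemigroup (FPplus n)} {e f g : Setoid (Fin n)}
    (h : CarriedBy (U : Set (FPplus n)) e f) (h' : CarriedBy (U : Set (FPplus n)) f g) :
    CarriedBy (U : Set (FPplus n)) e g := by
  obtain ⟨x, hx, hxc⟩ := h
  obtain ⟨y, hy, hyc⟩ := h'
  exact ⟨x * y, U.mul_mem hx hy, carries_mul_iff.2 ⟨_, hxc, hyc⟩⟩

theorem exists_setPow_subset_setPow_setPow {S : Type*} [Semigroup S] (T : Set S) (k m : ℕ) :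
    ∃ l, setPow T l ⊆ setPow (setPow T k) m := by
  have hadd : ∀ i j, setPow T (i + j + 1) ⊆ Set.image2 (· * ·) (setPow T i) (setPow T j) := by
    intro i j
    induction j with
    | zero => exact subset_rfl
    | succ j ih =>
      rintro _ ⟨x, hx, y, hy, rfl⟩
      obtain ⟨u, hu, v, hv, rfl⟩ := ih hx
      exact ⟨u, hu, v * y, ⟨v, hv, y, hy, rfl⟩, (mul_assoc u v y).symm⟩
  induction m with
  | zero => exact ⟨k, subset_rfl⟩
  | succ m ih =>
    obtain ⟨l, hl⟩ := ih
    exact ⟨l + k + 1, (hadd l k).trans (Set.image2_subset_right hl)⟩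

/-- If a product of `k + 1` elements of `U` carries `e` to `f`, then `f` has at least `k + 1`
predecessors in the strict order induced by `U`. -/
theorem lt_ncard_carriedBy {U : Subsemigroup (FPplus n)}
    (hirr : ∀ e, ¬CarriedBy (U : Set (FPplus n)) e e) (k : ℕ) :
    ∀ x ∈ setPow (U : Set (FPplus n)) k, ∀ e f, Carries x e f →
      k < {g | CarriedBy (U : Set (FPplus n)) g f}.ncard := by
  induction k with
  | zero =>
    intro x hx e f h
    have hne : {g | CarriedBy (U : Set (FPplus n)) g f}.Nonempty := ⟨e, x, hx, h⟩
    exact hne.ncard_pos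
  | succ k ih =>
    rintro _ ⟨x, hx, y, hy, rfl⟩ e f h
    obtain ⟨g, hxg, hyf⟩ := carries_mul_iff.1 h
    have hgf : CarriedBy (U : Set (FPplus n)) g f := ⟨y, hy, hyf⟩
    have hlt : {h | CarriedBy (U : Set (FPplus n)) h g}.ncard <
        {h | CarriedBy (U : Set (FPplus n)) h f}.ncard :=
      Set.ncard_lt_ncard ⟨fun h hh => hh.trans hgf, fun hsub => hirr g (hsub hgf)⟩
    have := ih x hx e g hxg
    omega

/-- A nonempty subsemigroup is nilpotent if and only if the relation it induces on partitions,
which is transitive, is irreflexive. -/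
theorem isNilpotentSet_subsemigroup_iff {U : Subsemigroup (FPplus n)} :
    IsNilpotentSet (U : Set (FPplus n)) ↔
      (U : Set (FPplus n)).Nonempty ∧ ∀ e, ¬CarriedBy (U : Set (FPplus n)) e e := by
  rw [isNilpotentSet_iff]
  refine and_congr_right fun _ => ⟨?_, fun hirr => ?_⟩
  · rintro ⟨k, hk⟩ e ⟨x, hx, hxe⟩
    have hpow : ∀ m, ∃ y ∈ setPow (U : Set (FPplus n)) m, Carries y e e := by
      intro m
      induction m with
      | zero => exact ⟨x, hx, hxe⟩
      | succ m ih =>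
        obtain ⟨y, hy, hye⟩ := ih
        exact ⟨y * x, ⟨y, hy, x, hx, rfl⟩, carries_mul_iff.2 ⟨e, hye, hxe⟩⟩
    obtain ⟨y, hy, hye⟩ := hpow k
    rw [hk hy] at hye
    exact not_carries_zero e e hye
  · -- Long products carry nothing, so they lie in the radical; long products of those vanish.
    obtain ⟨l, hl⟩ := exists_setPow_subset_setPow_setPow (U : Set (FPplus n))
      (Nat.card (Setoid (Fin n))) n
    refine ⟨l, hl.trans (setPow_subset_zero fun x hx => mem_radical_iff.1 ?_)⟩
    by_contra h
    obtain ⟨e, f, hef⟩ := notMem_radical_iff_exists_carries.1 h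
    exact (lt_ncard_carriedBy hirr _ x hx e f hef).not_ge (Set.ncard_le_card _)

/-! ### Maximal nilpotent subsemigroups and linear orders -/

theorem unionRel_iff {ρ : LinearOrders n} (k : Set.Icc 1 (n / 2)) (e f : M n k) :
    unionRel ρ e.1 f.1 ↔ (ρ k).1 e f := by
  refine ⟨?_, fun h => ⟨k, e.2, f.2, h⟩⟩
  rintro ⟨l, he, hf, h⟩
  obtain rfl : l = k := Subtype.ext (M_unique he e.2)
  exact h

theorem unionRel_irrefl (ρ : LinearOrders n) (e : Setoid (Fin n)) : ¬unionRel ρ e e := by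
  rintro ⟨k, _, _, h⟩
  have := (ρ k).2
  exact irrefl_of (ρ k).1 _ h

theorem unionRel_trans {ρ : LinearOrders n} {e f g : Setoid (Fin n)} (h : unionRel ρ e f)
    (h' : unionRel ρ f g) : unionRel ρ e g := by
  obtain ⟨k, he, hf, h⟩ := h
  obtain ⟨l, hf', hg, h'⟩ := h'
  obtain rfl : l = k := Subtype.ext (M_unique hf' hf)
  have := (ρ l).2
  exact ⟨l, he, hg, trans_of (ρ l).1 h h'⟩

theorem mem_Mon_iff {ρ : LinearOrders n} {x : FPplus n} :
    x ∈ Mon ρ ↔ ∀ e f, Carries x e f → unionRel ρ e f := by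
  refine forall₂_congr fun e f => ⟨fun h hx => ?_, fun h he hf hx => ?_⟩
  · exact h hx.ncard_left hx.ncard_right
      ((idem_mul_mul_idem_notMem_radical_iff hx.ncard_left hx.ncard_right).2 hx)
  · exact h ((idem_mul_mul_idem_notMem_radical_iff he hf).1 hx)

/-- `Mon ρ` as a subsemigroup. -/
def monSubsemigroup (ρ : LinearOrders n) : Subsemigroup (FPplus n) where
  carrier := Mon ρ
  mul_mem' {x y} hx hy := by
    rw [mem_Mon_iff] at *
    intro e g h
    obtain ⟨f, hxf, hyf⟩ := carries_mul_iff.1 h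
    exact unionRel_trans (hx _ _ hxf) (hy _ _ hyf)

/-- `Mon ρ` induces all of `ρ`, not only a part of it, because every pair of partitions of the same
type is the whole partial map of some element. -/
theorem carriedBy_Mon_iff {ρ : LinearOrders n} {e f : Setoid (Fin n)} :
    CarriedBy (Mon ρ) e f ↔ unionRel ρ e f := by
  constructor
  · rintro ⟨x, hx, h⟩
    exact mem_Mon_iff.1 hx e f h
  · rintro ⟨k, he, hf, h⟩
    obtain ⟨x, hx⟩ := exists_carries_iff k.2.1 he hf
    refine ⟨x, mem_Mon_iff.2 fun e' f' h' => ?_, (hx e f).2 ⟨rfl, rfl⟩⟩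
    obtain ⟨rfl, rfl⟩ := (hx e' f').1 h'
    exact ⟨k, he, hf, h⟩

theorem isNilpotentSet_Mon (ρ : LinearOrders n) :
    IsNilpotentSet (monSubsemigroup ρ : Set (FPplus n)) :=
  isNilpotentSet_subsemigroup_iff.2 ⟨⟨0, mem_Mon_iff.2 fun e f h => (not_carries_zero e f h).elim⟩,
    fun e h => unionRel_irrefl ρ e (carriedBy_Mon_iff.1 h)⟩

/-- A nilpotent subsemigroup above `Mon ρ` induces a strict order that extends the linear orders
`ρ`, hence the same order. -/
theorem isMaximalNilpotent_Mon (ρ : LinearOrders n) : IsMaximalNilpotent (monSubsemigroup ρ) := by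
  refine ⟨isNilpotentSet_Mon ρ, fun U hU hle x hx => mem_Mon_iff.2 fun e f h => ?_⟩
  have hirr := (isNilpotentSet_subsemigroup_iff.1 hU).2
  obtain ⟨k, he⟩ := exists_mem_M h.ncard_left
  have hf := h.mem_M he
  have hef : CarriedBy (U : Set (FPplus n)) e f := ⟨x, hx, h⟩
  have := (ρ k).2
  rcases trichotomous_of (ρ k).1 ⟨e, he⟩ ⟨f, hf⟩ with hlt | heq | hgt
  · exact ⟨k, he, hf, hlt⟩
  · obtain rfl : e = f := congrArg Subtype.val heq
    exact (hirr _ hef).elim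
  · obtain ⟨y, hy, hyc⟩ := carriedBy_Mon_iff.2 ⟨k, hf, he, hgt⟩
    exact (hirr _ (hef.trans ⟨y, hle hy, hyc⟩)).elim

theorem exists_isStrictTotalOrder_ge {α : Type*} (r : α → α → Prop) [IsStrictOrder α r] :
    ∃ s : α → α → Prop, IsStrictTotalOrder α s ∧ r ≤ s := by
  let := partialOrderOfSO r
  let g : α →o LinearExtension α := toLinearExtension
  have hg : Function.Injective g := fun a b h => h
  refine ⟨fun a b => g a < g b, { trichotomous := ?_, irrefl := ?_, trans := ?_ }, ?_⟩
  · intro a b hab hba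
    exact hg (le_antisymm (not_lt.1 hba) (not_lt.1 hab))
  · exact fun a => lt_irrefl _
  · exact fun a b c => lt_trans
  · intro a b hab
    exact lt_of_le_of_ne (g.monotone (Or.inr hab)) fun h => ne_of_irrefl hab (hg h)

/-- Every nilpotent subsemigroup lies in some `Mon ρ`: extend the strict order it induces. -/
theorem exists_le_Mon {U : Subsemigroup (FPplus n)} (hU : IsNilpotentSet (U : Set (FPplus n))) :
    ∃ ρ : LinearOrders n, U ≤ monSubsemigroup ρ := by
  have hirr := (isNilpotentSet_subsemigroup_iff.1 hU).2
  have hext : ∀ k : Set.Icc 1 (n / 2), ∃ s : M n k → M n k → Prop, IsStrictTotalOrder (M n k) s ∧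
      (fun e f : M n k => CarriedBy (U : Set (FPplus n)) e.1 f.1) ≤ s := fun k => by
    have : IsStrictOrder (M n k) (fun e f : M n k => CarriedBy (U : Set (FPplus n)) e.1 f.1) :=
      { irrefl := fun e => hirr e.1, trans := fun _ _ _ h h' => h.trans h' }
    exact exists_isStrictTotalOrder_ge _
  choose s hs hle using hext
  refine ⟨fun k => ⟨s k, hs k⟩, fun x hx => mem_Mon_iff.2 fun e f h => ?_⟩
  obtain ⟨k, he⟩ := exists_mem_M h.ncard_left
  exact ⟨k, he, h.mem_M he, hle k ⟨e, he⟩ ⟨f, h.mem_M he⟩ ⟨x, hx, h⟩⟩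

theorem exists_eq_Mon (T : MaxNil n) : ∃ ρ : LinearOrders n, T.1 = monSubsemigroup ρ := by
  obtain ⟨ρ, hρ⟩ := exists_le_Mon T.2.prop
  exact ⟨ρ, T.2.eq_of_le (isNilpotentSet_Mon ρ) hρ⟩

theorem inducedRel_Mon_iff {ρ : LinearOrders n} (k : Set.Icc 1 (n / 2)) (e f : M n k) :
    inducedRel (Mon ρ) e.1 f.1 ↔ (ρ k).1 e f := by
  rw [inducedRel_iff_carriedBy e.2.1 f.2.1, carriedBy_Mon_iff, unionRel_iff]

theorem isStrictTotalOrder_inducedRel (T : MaxNil n) (k : Set.Icc 1 (n / 2)) :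
    IsStrictTotalOrder (M n k) fun e f => inducedRel (T.1 : Set (FPplus n)) e.1 f.1 := by
  obtain ⟨ρ, hρ⟩ := exists_eq_Mon T
  have h : (fun e f : M n k => inducedRel (T.1 : Set (FPplus n)) e.1 f.1) = (ρ k).1 := by
    funext e f
    rw [hρ]
    exact propext (inducedRel_Mon_iff k e f)
  rw [h]
  exact (ρ k).2

/-- The bijection between maximal nilpotent subsemigroups and collections of linear orders. -/
def maxNilEquiv (n : ℕ) : MaxNil n ≃ LinearOrders n where
  toFun T k := ⟨fun e f => inducedRel (T.1 : Set (FPplus n)) e.1 f.1,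
    isStrictTotalOrder_inducedRel T k⟩
  invFun ρ := ⟨monSubsemigroup ρ, isMaximalNilpotent_Mon ρ⟩
  left_inv T := by
    obtain ⟨ρ, hρ⟩ := exists_eq_Mon T
    obtain ⟨T, hT⟩ := T
    subst hρ
    refine Subtype.ext (congrArg monSubsemigroup ?_)
    funext k
    exact Subtype.ext (funext₂ fun e f => propext (inducedRel_Mon_iff k e f))
  right_inv ρ := by
    funext k
    exact Subtype.ext (funext₂ fun e f => propext (inducedRel_Mon_iff k e f))

/-! ### Counting -/

/-- Linear orders on a finite type with `m` elements correspond to its enumerations by `Fin m`. -/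
theorem card_isStrictTotalOrder (α : Type*) [Finite α] :
    Nat.card {r : α → α → Prop // IsStrictTotalOrder α r} = (Nat.card α)! := by
  classical
  have := Fintype.ofFinite α
  let F : (α ≃ Fin (Fintype.card α)) → {r : α → α → Prop // IsStrictTotalOrder α r} := fun σ =>
    ⟨fun a b => σ a < σ b,
      { trichotomous := fun a b hab hba =>
          σ.injective (le_antisymm (not_lt.1 hba) (not_lt.1 hab))
        irrefl := fun a => lt_irrefl _
        trans := fun a b c => lt_trans }⟩
  have hF : Function.Bijective F := by
    constructor
    · intro σ τ h
      have h' : ∀ a b, σ a < σ b ↔ τ a < τ b := fun a b =>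
        iff_of_eq (congrFun₂ (congrArg Subtype.val h) a b)
      -- `σ⁻¹ τ` is an order automorphism of `Fin m`, hence trivial.
      let g : Fin (Fintype.card α) ≃o Fin (Fintype.card α) :=
        { σ.symm.trans τ with
          map_rel_iff' := fun {i j} => by
            have := h' (σ.symm j) (σ.symm i)
            simp only [Equiv.apply_symm_apply] at this
            rw [← not_lt, ← not_lt, this]
            rfl }
      have hg : g = OrderIso.refl _ := Subsingleton.elim _ _
      ext a
      have := DFunLike.congr_fun hg (σ a)
      have h2 : τ (σ.symm (σ a)) = σ a := this
      rw [← h2, σ.symm_apply_apply]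
    · rintro ⟨r, hr⟩
      let := linearOrderOfSTO r
      let g : Fin (Fintype.card α) ≃o α := Fintype.orderIsoFinOfCardEq α rfl
      exact ⟨g.symm.toEquiv, Subtype.ext (funext₂ fun a b => propext g.symm.lt_iff_lt)⟩
  rw [← Nat.card_congr (Equiv.ofBijective F hF), Nat.card_eq_fintype_card,
    Fintype.card_equiv (Fintype.equivFin α), Nat.card_eq_fintype_card]

theorem ncard_setOf_ncard_eq (n k : ℕ) : {A : Set (Fin n) | A.ncard = k}.ncard = n.choose k := by
  have himage : {A : Set (Fin n) | A.ncard = k} =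
      (fun A : Finset (Fin n) => (A : Set (Fin n))) '' Set.powersetCard (Fin n) k := by
    ext A
    constructor
    · rintro rfl
      exact ⟨A.toFinite.toFinset, (Set.ncard_eq_toFinset_card A).symm, by simp⟩
    · rintro ⟨A, hA, rfl⟩
      exact (Set.ncard_coe_finset A).trans hA
  rw [himage, Set.ncard_image_of_injective _ Finset.coe_injective, ← Nat.card_coe_set_eq,
    Set.powersetCard.card, Nat.card_eq_fintype_card, Fintype.card_fin]

theorem ncard_M_of_two_mul_lt {k : ℕ} (hk : 1 ≤ k) (h : 2 * k < n) :
    (M n k).ncard = n.choose k := by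
  have himage : M n k = twoBlock '' {A : Set (Fin n) | A.ncard = k} := by
    ext r
    rw [mem_M_iff hk]
    constructor
    · rintro ⟨A, hA, -, rfl⟩
      exact ⟨A, hA, rfl⟩
    · rintro ⟨A, hA, rfl⟩
      exact ⟨A, hA, h.le, rfl⟩
  rw [himage, Set.InjOn.ncard_image, ncard_setOf_ncard_eq]
  intro A hA B hB hAB
  refine (twoBlock_inj hAB).resolve_right ?_
  rintro rfl
  simp only [Set.mem_ofPred_eq] at hA hB
  rw [Set.ncard_compl, Nat.card_eq_fintype_card, Fintype.card_fin] at hA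
  omega

/-- If the blocks have the same size, each partition comes from two subsets. -/
theorem two_mul_ncard_M {k : ℕ} (hk : 1 ≤ k) (h : n = 2 * k) :
    2 * (M n k).ncard = n.choose k := by
  let a : Fin n := ⟨0, by omega⟩
  have hcompl : ∀ A : Set (Fin n), A.ncard = k → Aᶜ.ncard = k := fun A hA => by
    rw [Set.ncard_compl, Nat.card_eq_fintype_card, Fintype.card_fin]
    omega
  -- Exactly one of the two blocks contains `a`, and exactly one does not.
  have hin : (M n k).ncard = {A : Set (Fin n) | A.ncard = k ∧ a ∈ A}.ncard := by
    rw [← Set.InjOn.ncard_image (f := twoBlock)]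
    · congr 1
      ext r
      rw [mem_M_iff hk]
      constructor
      · rintro ⟨A, hA, -, rfl⟩
        by_cases ha : a ∈ A
        exacts [⟨A, ⟨hA, ha⟩, rfl⟩, ⟨Aᶜ, ⟨hcompl A hA, ha⟩, twoBlock_compl A⟩]
      · rintro ⟨A, hA, rfl⟩
        exact ⟨A, hA.1, h.ge, rfl⟩
    · intro A hA B hB hAB
      refine (twoBlock_inj hAB).resolve_right ?_
      rintro rfl
      exact hA.2 hB.2
  have hout : {A : Set (Fin n) | A.ncard = k ∧ a ∉ A}.ncard =
      {A : Set (Fin n) | A.ncard = k ∧ a ∈ A}.ncard := by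
    rw [← Set.ncard_image_of_injective _ (compl_injective (α := Set (Fin n)))]
    congr 1
    ext A
    constructor
    · rintro ⟨B, hB, rfl⟩
      exact ⟨hcompl B hB.1, hB.2⟩
    · rintro ⟨hA, ha⟩
      exact ⟨Aᶜ, ⟨hcompl A hA, fun h => h ha⟩, compl_compl A⟩
  have hunion : {A : Set (Fin n) | A.ncard = k} =
      {A : Set (Fin n) | A.ncard = k ∧ a ∈ A} ∪ {A : Set (Fin n) | A.ncard = k ∧ a ∉ A} := by
    ext A
    simp only [Set.mem_union, Set.mem_ofPred_eq]
    tauto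
  rw [← ncard_setOf_ncard_eq, hunion, Set.ncard_union_eq, hout, ← hin, two_mul]
  exact Set.disjoint_left.2 fun A hA hA' => hA'.2 hA.2

theorem card_maxNil (n : ℕ) :
    Nat.card (MaxNil n) = ∏ i ∈ Finset.Icc 1 (n / 2), ((M n i).ncard)! := by
  rw [Nat.card_congr (maxNilEquiv n), Nat.card_pi]
  simp only [card_isStrictTotalOrder, Nat.card_coe_set_eq]
  exact (Finset.prod_subtype _ (fun i => by simp) (fun i => ((M n i).ncard)!)).symm

end NilFP

theorem theorem6p12 (n : ℕ) (hn : 1 ≤ n) :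
    (∃ Φ : NilFP.MaxNil n ≃ NilFP.LinearOrders n,
      (∀ (T : NilFP.MaxNil n) (k : Set.Icc 1 (n / 2)) (e f : NilFP.M n k),
        (Φ T k).1 e f ↔ NilFP.inducedRel (T.1 : Set (NilFP.FPplus n)) e.1 f.1) ∧
      (∀ ρ : NilFP.LinearOrders n,
        ((Φ.symm ρ).1 : Set (NilFP.FPplus n)) = NilFP.Mon ρ)) ∧
    (∀ k : ℕ, n = 2 * k + 1 →
      Nat.card (NilFP.MaxNil n) = ∏ i ∈ Finset.Icc 1 k, (n.choose i)!) ∧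
    (∀ k : ℕ, n = 2 * k →
      Nat.card (NilFP.MaxNil n) =
        (n.choose k / 2)! * ∏ i ∈ Finset.Icc 1 (k - 1), (n.choose i)!) := by
  refine ⟨⟨NilFP.maxNilEquiv n, fun _ _ _ _ => Iff.rfl, fun _ => rfl⟩, fun k hk => ?_,
    fun k hk => ?_⟩
  · rw [NilFP.card_maxNil, show n / 2 = k by omega]
    refine Finset.prod_congr rfl fun i hi => ?_
    rw [Finset.mem_Icc] at hi
    rw [NilFP.ncard_M_of_two_mul_lt hi.1 (by omega)]
  · have hM := NilFP.two_mul_ncard_M (k := k) (by omega) hk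
    obtain ⟨k, rfl⟩ : ∃ l, k = l + 1 := ⟨k - 1, by omega⟩
    rw [NilFP.card_maxNil, show n / 2 = k + 1 by omega, Finset.prod_Icc_succ_top (by omega),
      Nat.add_sub_cancel, mul_comm, show (NilFP.M n (k + 1)).ncard = n.choose (k + 1) / 2 by omega]
    congr 1
    refine Finset.prod_congr rfl fun i hi => ?_
    rw [Finset.mem_Icc] at hi
    rw [NilFP.ncard_M_of_two_mul_lt hi.1 (by omega)]
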